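/- Let $n\ge 0$ and let $\mathcal F_n$ be the set of all functions $\{0,1\}^n\to\{0,1\}^n$. For $F\in\mathcal F_n$ and $k\in\{0,1\}^n$ let $E_k[F]\in\mathcal F_n$ be the forward-only one-key cipher $E_k[F](x)=F(x\oplus k)$. Let $\mathcal A$ be a quantum algorithm with output in $\{0,1\}$ that has classical access to a first oracle $O\in\mathcal F_n$ (it submits a string $x$ and receives $O(x)$) and quantum access to a second oracle $G\in\mathcal F_n$ (it may apply the unitary $|x\rangle|y\rangle\mapsto|x\rangle|y\oplus G(x)\rangle$ to its registers). Between queries $\mathcal A$ may apply arbitrary quantum operations and measurements on a finite-dimensional space, and it may choose its actions, its classical queries and the order of its queries adaptively, depending on all measurement outcomes and replies obtained so far. Suppose that, on every run, $\mathcal A$ makes at most $q_E$ classical queries to its first oracle and at most $q_F$ quantum queries to its second oracle. Then $$\left|\Pr_{\substack{k\leftarrow\{0,1\}^n\\ F\leftarrow\mathcal F_n}}\left[\mathcal A^{E_k[F],F}(1^n)=1\right]-\Pr_{R,F\leftarrow\mathcal F_n}\left[\mathcal A^{R,F}(1^n)=1\right]\right|\le 2^{-n/2}\left(2q_E\sqrt{q_F}+2q_F\sqrt{q_E}\right),$$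 where $k$, $F$ and $R$ are uniform and independent. -/

import Mathlib

open scoped Matrix BigOperators

/-- Bit strings of length `n`, as vectors over `𝔽₂`: addition is the bitwise XOR `⊕`. -/
abbrev Bits (n : ℕ) : Type := Fin n → ZMod 2

/-- Computational basis of the registers of an adversary: the oracle's input register `X` and
output register `Y`, of `n` qubits each, and a work register `W` of dimension `d`. -/
abbrev RegBasis (n d : ℕ) : Type := Bits n × Bits n × Fin d

/-- (Possibly subnormalised) state vectors of the registers `X`, `Y`, `W`. -/
abbrev RegState (n d : ℕ) : Type := RegBasis n d → ℂ

/-- The forward-only one-key cipher `E_k[F](x) = F(x ⊕ k)`. -/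
def forwardCipher {n : ℕ} (F : Bits n → Bits n) (k : Bits n) : Bits n → Bits n :=
  fun x => F (x + k)

/-- One quantum query to `F`: the unitary `|x⟩|y⟩|w⟩ ↦ |x⟩|y ⊕ F(x)⟩|w⟩`. As `⊕` is an involution,
the new amplitude at `(x, y, w)` is the old amplitude at `(x, y ⊕ F(x), w)`. -/
def quantumOracle {n d : ℕ} (F : Bits n → Bits n) (ψ : RegState n d) : RegState n d :=
  fun b => ψ (b.1, b.2.1 + F b.1, b.2.2)

/-- Action of a quantum query on the computational basis. -/
theorem quantumOracle_single {n d : ℕ} (F : Bits n → Bits n) (x y : Bits n) (w : Fin d) :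
    quantumOracle F (Pi.single (x, y, w) 1) = Pi.single (x, y + F x, w) 1 := by
  have h2 : ∀ a : Bits n, a + a = 0 := fun a => by
    funext i; exact CharTwo.add_self_eq_zero (a i)
  funext ⟨x', y', w'⟩
  simp only [quantumOracle, Pi.single_apply, Prod.mk.injEq]
  refine if_congr ⟨?_, ?_⟩ rfl rfl
  · rintro ⟨rfl, h, rfl⟩
    exact ⟨rfl, by rw [← h, add_assoc, h2, add_zero], rfl⟩
  · rintro ⟨rfl, h, rfl⟩
    exact ⟨rfl, by rw [h, add_assoc, h2, add_zero], rfl⟩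

/-- The program of an adaptive quantum algorithm on the registers `X`, `Y`, `W`, with a classical
and a quantum oracle. All classical control (outcomes of measurements, replies of the classical
oracle) is recorded by the position in the tree, so every instruction, every classical query and
the kind of the next query may depend on it.

`measure K _ next` performs an arbitrary measurement with Kraus operators `K 0, …, K (m - 1)` and
goes on with `next i` on outcome `i`. A unitary is the case `m = 1`; an arbitrary quantum channel,
or an arbitrary quantum instrument, is obtained by ignoring (part of) the outcome. -/
inductive AdvProgram (n d : ℕ) : Type
  /-- Stop and output a bit. -/
  | output (b : Bool) : AdvProgram n d
  /-- A local quantum operation. -/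
  | measure {m : ℕ} (K : Fin m → Matrix (RegBasis n d) (RegBasis n d) ℂ)
      (hK : ∑ i, (K i)ᴴ * K i = 1) (next : Fin m → AdvProgram n d) : AdvProgram n d
  /-- Submit the string `x` to the classical oracle and go on according to the reply. -/
  | classicalQuery (x : Bits n) (next : Bits n → AdvProgram n d) : AdvProgram n d
  /-- Apply the unitary of the quantum oracle to the registers `X`, `Y`. -/
  | quantumQuery (next : AdvProgram n d) : AdvProgram n d

namespace AdvProgram

/-- The largest number of classical queries on a run of the program. -/
def classicalQueries {n d : ℕ} : AdvProgram n d → ℕ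
  | output _ => 0
  | measure _ _ next => Finset.univ.sup fun i => (next i).classicalQueries
  | classicalQuery _ next => (Finset.univ.sup fun y => (next y).classicalQueries) + 1
  | quantumQuery next => next.classicalQueries

/-- The largest number of quantum queries on a run of the program. -/
def quantumQueries {n d : ℕ} : AdvProgram n d → ℕ
  | output _ => 0
  | measure _ _ next => Finset.univ.sup fun i => (next i).quantumQueries
  | classicalQuery _ next => Finset.univ.sup fun y => (next y).quantumQueries
  | quantumQuery next => next.quantumQueries + 1

/-- Probability (Born rule) that the program, run on `ψ` with classical oracle `O` and quantum
oracle `F`, outputs `1`. States after a measurement are not renormalised: their squared norm is the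
probability of the outcomes seen so far. -/
noncomputable def acceptProb {n d : ℕ} (O F : Bits n → Bits n) :
    AdvProgram n d → RegState n d → ℝ
  | output b, ψ => if b then ∑ i, ‖ψ i‖ ^ 2 else 0
  | measure K _ next, ψ => ∑ i, (next i).acceptProb O F (K i *ᵥ ψ)
  | classicalQuery x next, ψ => (next (O x)).acceptProb O F ψ
  | quantumQuery next, ψ => next.acceptProb O F (quantumOracle F ψ)

end AdvProgram

/-- A quantum algorithm (for security parameter `n`) with two oracles for functions
`{0,1}ⁿ → {0,1}ⁿ`, the first classical and the second quantum. -/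
structure OracleAdversary (n : ℕ) where
  /-- Dimension of the work register. -/
  workDim : ℕ
  /-- Initial state of the registers. -/
  init : RegState n workDim
  init_norm : ∑ i, ‖init i‖ ^ 2 = 1
  /-- What the algorithm does. -/
  program : AdvProgram n workDim

namespace OracleAdversary

/-- `Pr[A^{O, F} = 1]`, with classical access to `O` and quantum access to `F`. -/
noncomputable def prob {n : ℕ} (A : OracleAdversary n) (O F : Bits n → Bits n) : ℝ :=
  A.program.acceptProb O F A.init

/-- On every run, `A` makes at most `qE` classical queries to its first oracle and at most `qF`
quantum queries to its second oracle. -/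
def MakesQueries {n : ℕ} (A : OracleAdversary n) (qE qF : ℕ) : Prop :=
  A.program.classicalQueries ≤ qE ∧ A.program.quantumQueries ≤ qF

end OracleAdversary

/-! The run is replayed with a state $\Psi(F)$ that depends on $F$ alone, neither on $k$ nor on the
table $T$, whose replies are drawn uniformly and independently; in the real world the oracles are
$F$ reprogrammed to $T$, shifted by $k$. At an output only $\Psi(F)$ matters, so both worlds agree,
and it remains to charge each query for the replacement it needs.

A fresh classical query reveals $F(x\oplus k)$ at a uniform point. Replacing it by an independent
value is harmless as far as $\Psi$ does not depend on that coordinate. Amplitudes after $q$ quantum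
queries have Fourier degree at most $q$, so their total influence is at most $q$, and averaging over
$k$ leaves mean-square dependence $q/2^n$. The cost is $2\sqrt{q/2^n}$
(`abs_realProb_classicalQuery_sub_le`).

A quantum query to the reprogrammed function differs from one to $F$ only on the shifted table. As
$\Psi$ does not depend on $k$, its weight there averages to $j/2^n$ for $j$ entries, and the cost is
$2\sqrt{j/2^n}$ (`abs_realProb_quantumQuery_sub_le`).

With $q\le q_F$ and $j\le q_E$ throughout, the costs add up to the bound
(`abs_realProb_sub_idealProb_le`). All estimates scale with the squared norm of the state, so they
sum exactly over measurement outcomes. -/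

/-! ### Fourier analysis of functions of a random function -/

section Fourier

variable {ι B : Type*} [Fintype ι] [DecidableEq ι] [AddCommGroup B] [Fintype B]

/-- The coordinates on which a character of `ι → B` depends. -/
noncomputable def charSupport (χ : AddChar (ι → B) ℂ) : Finset ι :=
  open Classical in Finset.univ.filter fun x => ∃ b, χ (Pi.single x b) ≠ 1

/-- The (unnormalised) Fourier coefficient of `f` at the character `χ`. -/
noncomputable def charCoeff (f : (ι → B) → ℂ) (χ : AddChar (ι → B) ℂ) : ℂ :=
  ∑ F, f F * χ F

/-- `f` has no Fourier coefficient at characters that depend on more than `q` coordinates. -/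
def HasFourierDegreeLE (q : ℕ) (f : (ι → B) → ℂ) : Prop :=
  ∀ χ : AddChar (ι → B) ℂ, q < (charSupport χ).card → charCoeff f χ = 0

/-- The average of `f` over all values of its argument at the coordinate `s`. -/
noncomputable def resampleMean {E : Type*} [AddCommMonoid E] [Module ℚ≥0 E]
    (s : ι) (f : (ι → B) → E) (F : ι → B) : E :=
  𝔼 y, f (Function.update F s y)

omit [Fintype ι] [Fintype B] in
theorem update_eq_add_single (F : ι → B) (s : ι) (y : B) :
    Function.update F s (F s + y) = F + Pi.single s y := by
  ext x
  by_cases h : x = s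
  · subst h; simp
  · simp [h]

omit [Fintype ι] in
theorem resampleMean_eq_expect_add_single {E : Type*} [AddCommMonoid E] [Module ℚ≥0 E]
    (s : ι) (f : (ι → B) → E) (F : ι → B) :
    resampleMean s f F = 𝔼 y, f (F + Pi.single s y) := by
  symm
  exact Fintype.expect_equiv (Equiv.addLeft (F s)) _ _ fun y => by
    simp [← update_eq_add_single]

/-- Resampling one value of a uniformly random function does not change its distribution. -/
theorem expect_resampleMean {E : Type*} [AddCommMonoid E] [Module ℚ≥0 E] (s : ι)
    (f : (ι → B) → E) : 𝔼 F, resampleMean s f F = 𝔼 F, f F := by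
  classical
  simp only [resampleMean_eq_expect_add_single]
  rw [Finset.expect_comm]
  have h : ∀ y : B, 𝔼 F : ι → B, f (F + Pi.single s y) = 𝔼 F, f F := fun y =>
    Fintype.expect_equiv (Equiv.addRight (Pi.single s y)) _ _ fun F => rfl
  simp only [h]
  exact Fintype.expect_const _

theorem charCoeff_add (f g : (ι → B) → ℂ) (χ : AddChar (ι → B) ℂ) :
    charCoeff (f + g) χ = charCoeff f χ + charCoeff g χ := by
  simp [charCoeff, add_mul, Finset.sum_add_distrib]

theorem charCoeff_sub (f g : (ι → B) → ℂ) (χ : AddChar (ι → B) ℂ) :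
    charCoeff (f - g) χ = charCoeff f χ - charCoeff g χ := by
  simp [charCoeff, sub_mul, Finset.sum_sub_distrib]

open Classical in
theorem expect_addChar_single (χ : AddChar (ι → B) ℂ) (s : ι) :
    𝔼 y, χ (Pi.single s y) = if s ∈ charSupport χ then 0 else 1 := by
  have h := AddChar.expect_eq_ite (χ.compAddMonoidHom (AddMonoidHom.single (fun _ => B) s))
  simp only [AddChar.compAddMonoidHom_apply, AddMonoidHom.single_apply] at h
  rw [h, ← ite_not]
  refine if_congr ?_ rfl rfl
  rw [not_iff_comm]
  simp [charSupport, AddChar.ext_iff]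

-- Averaging over one coordinate is the Fourier projection that kills exactly the characters
-- depending on it.
open Classical in
theorem charCoeff_resampleMean (f : (ι → B) → ℂ) (s : ι) (χ : AddChar (ι → B) ℂ) :
    charCoeff (resampleMean s f) χ = if s ∈ charSupport χ then 0 else charCoeff f χ := by
  have h1 : charCoeff (resampleMean s f) χ
      = 𝔼 y, ∑ F, f (F + Pi.single s y) * χ F := by
    simp only [charCoeff, resampleMean_eq_expect_add_single]
    rw [Finset.expect_sum_comm]
    simp only [Finset.expect_mul]
  have h2 : ∀ y : B, ∑ F, f (F + Pi.single s y) * χ F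
      = charCoeff f χ * χ (Pi.single s (-y)) := fun y => by
    rw [charCoeff, Finset.sum_mul]
    refine Fintype.sum_equiv (Equiv.addRight (Pi.single s y)) _ _ fun F => ?_
    simp only [Equiv.coe_addRight, AddChar.map_add_eq_mul, Pi.single_neg]
    rw [mul_assoc, mul_assoc, ← AddChar.map_add_eq_mul]
    simp
  simp only [h1, h2]
  rw [← Finset.mul_expect, Fintype.expect_equiv (Equiv.neg B) (fun y => χ (Pi.single s (-y)))
    (fun y => χ (Pi.single s y)) (fun _ => rfl), expect_addChar_single]
  split_ifs <;> simp

/-- Parseval's identity. -/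
theorem sum_norm_sq_charCoeff (f : (ι → B) → ℂ) :
    ∑ χ, ‖charCoeff f χ‖ ^ 2 = Fintype.card (ι → B) * ∑ F, ‖f F‖ ^ 2 := by
  classical
  have key : ∑ χ, charCoeff f χ * (starRingEnd ℂ) (charCoeff f χ)
      = Fintype.card (ι → B) * ∑ F, f F * (starRingEnd ℂ) (f F) := by
    calc ∑ χ, charCoeff f χ * (starRingEnd ℂ) (charCoeff f χ)
        = ∑ χ : AddChar (ι → B) ℂ, ∑ F, ∑ F', f F * (starRingEnd ℂ) (f F') * χ (F - F') := by
          refine Finset.sum_congr rfl fun χ _ => ?_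
          simp only [charCoeff, map_sum, map_mul, Finset.sum_mul_sum]
          refine Finset.sum_congr rfl fun F _ => Finset.sum_congr rfl fun F' _ => ?_
          rw [sub_eq_add_neg, AddChar.map_add_eq_mul, AddChar.map_neg_eq_conj]
          ring
      _ = ∑ F, ∑ F', f F * (starRingEnd ℂ) (f F') * ∑ χ : AddChar (ι → B) ℂ, χ (F - F') := by
          rw [Finset.sum_comm]
          refine Finset.sum_congr rfl fun F _ => ?_
          rw [Finset.sum_comm]
          simp only [Finset.mul_sum]
      _ = _ := by
          simp only [AddChar.sum_apply_eq_ite, sub_eq_zero, mul_ite, mul_zero,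
            Finset.sum_ite_eq, Finset.mem_univ, if_true]
          rw [Finset.mul_sum]
          exact Finset.sum_congr rfl fun F _ => by ring
  simp only [Complex.mul_conj, Complex.normSq_eq_norm_sq] at key
  exact_mod_cast key

/-- The total influence of a function is at most its degree. -/
theorem sum_sum_norm_sq_sub_resampleMean_le {q : ℕ} {f : (ι → B) → ℂ}
    (hf : HasFourierDegreeLE q f) :
    ∑ s, ∑ F, ‖f F - resampleMean s f F‖ ^ 2 ≤ q * ∑ F, ‖f F‖ ^ 2 := by
  classical
  have hN : (0 : ℝ) < Fintype.card (ι → B) := by exact_mod_cast Fintype.card_pos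
  refine le_of_mul_le_mul_left ?_ hN
  rw [mul_left_comm, ← sum_norm_sq_charCoeff, Finset.mul_sum]
  have h : ∀ s, (Fintype.card (ι → B) : ℝ) * ∑ F, ‖f F - resampleMean s f F‖ ^ 2
      = ∑ χ, if s ∈ charSupport χ then ‖charCoeff f χ‖ ^ 2 else 0 := fun s => by
    have := sum_norm_sq_charCoeff (f - resampleMean s f)
    simp only [Pi.sub_apply] at this
    rw [← this]
    refine Finset.sum_congr rfl fun χ _ => ?_
    rw [charCoeff_sub, charCoeff_resampleMean]
    split_ifs <;> simp
  simp only [h]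
  -- Summed over all coordinates, each squared coefficient is counted once per element of its
  -- support.
  rw [Finset.sum_comm, Finset.mul_sum]
  refine Finset.sum_le_sum fun χ _ => ?_
  rw [Finset.sum_ite_mem, Finset.univ_inter, Finset.sum_const, nsmul_eq_mul]
  by_cases hq : q < (charSupport χ).card
  · simp [hf χ hq]
  · have : ((charSupport χ).card : ℝ) ≤ q := by exact_mod_cast not_lt.1 hq
    gcongr

/-- Each Fourier coefficient is multiplied by 1 or 2, hence its square by at most 4. -/
theorem sum_norm_sq_add_resampleMean_le (s : ι) (f : (ι → B) → ℂ) :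
    ∑ F, ‖f F + resampleMean s f F‖ ^ 2 ≤ 4 * ∑ F, ‖f F‖ ^ 2 := by
  classical
  have hN : (0 : ℝ) < Fintype.card (ι → B) := by exact_mod_cast Fintype.card_pos
  refine le_of_mul_le_mul_left ?_ hN
  have := sum_norm_sq_charCoeff (f + resampleMean s f)
  simp only [Pi.add_apply] at this
  rw [← this, mul_left_comm, ← sum_norm_sq_charCoeff, Finset.mul_sum]
  refine Finset.sum_le_sum fun χ _ => ?_
  rw [charCoeff_add, charCoeff_resampleMean]
  split_ifs
  · rw [add_zero]; nlinarith [sq_nonneg ‖charCoeff f χ‖]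
  · rw [← two_mul, norm_mul]; norm_num [mul_pow]

theorem HasFourierDegreeLE.sum {κ : Type*} {q : ℕ} (t : Finset κ) {f : κ → (ι → B) → ℂ}
    (hf : ∀ i ∈ t, HasFourierDegreeLE q (f i)) :
    HasFourierDegreeLE q fun F => ∑ i ∈ t, f i F := fun χ hχ => by
  simp only [charCoeff, Finset.sum_mul]
  rw [Finset.sum_comm]
  exact Finset.sum_eq_zero fun i hi => hf i hi χ hχ

theorem HasFourierDegreeLE.const_mul {q : ℕ} {f : (ι → B) → ℂ} (hf : HasFourierDegreeLE q f)
    (c : ℂ) : HasFourierDegreeLE q fun F => c * f F := fun χ hχ => by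
  have := hf χ hχ
  simp only [charCoeff, mul_assoc] at this ⊢
  rw [← Finset.mul_sum, this, mul_zero]

theorem hasFourierDegreeLE_const (c : ℂ) :
    HasFourierDegreeLE 0 fun _ : ι → B => c := fun χ hχ => by
  classical
  obtain ⟨x, hx⟩ := Finset.card_pos.1 hχ
  have hne : χ ≠ 0 := by
    rintro rfl
    simp [charSupport] at hx
  simp only [charCoeff]
  rw [← Finset.mul_sum, AddChar.sum_eq_zero_iff_ne_zero.2 hne, mul_zero]

/-- Multiplication by a function of the value at one coordinate raises the degree by at most
one. -/
theorem HasFourierDegreeLE.mul_char_eval {q : ℕ} {f : (ι → B) → ℂ}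
    (hf : HasFourierDegreeLE q f) (x : ι) (φ : AddChar B ℂ) :
    HasFourierDegreeLE (q + 1) fun F => f F * φ (F x) := fun χ hχ => by
  classical
  let φ' : AddChar (ι → B) ℂ := φ.compAddMonoidHom (Pi.evalAddMonoidHom (fun _ => B) x)
  have hφ : ∀ F, φ' F = φ (F x) := fun F => rfl
  have hsub : charSupport χ ⊆ insert x (charSupport (φ' * χ)) := fun z hz => by
    by_cases hzx : z = x
    · simp [hzx]
    · refine Finset.mem_insert_of_mem ?_
      simp only [charSupport, Finset.mem_filter, Finset.mem_univ, true_and] at hz ⊢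
      obtain ⟨b, hb⟩ := hz
      refine ⟨b, ?_⟩
      rw [AddChar.mul_apply, hφ, Pi.single_eq_of_ne (Ne.symm hzx), AddChar.map_zero_eq_one,
        one_mul]
      exact hb
  have hcard := (Finset.card_le_card hsub).trans (Finset.card_insert_le _ _)
  -- Multiplying by a character of `F x` can remove at most the coordinate `x` from the support.
  have := hf (φ' * χ) (by omega)
  simpa only [charCoeff, AddChar.mul_apply, hφ, mul_assoc] using this

/-- The indicator of `F x = z` is a combination of characters of `F x`, by orthogonality on `B`. -/
theorem HasFourierDegreeLE.mul_indicator [DecidableEq B] {q : ℕ} {f : (ι → B) → ℂ}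
    (hf : HasFourierDegreeLE q f) (x : ι) (z : B) :
    HasFourierDegreeLE (q + 1) fun F => if F x = z then f F else 0 := by
  have h : (fun F : ι → B => if F x = z then f F else 0)
      = fun F => ∑ φ : AddChar B ℂ, ((Fintype.card B : ℂ)⁻¹ * φ (-z)) * (f F * φ (F x)) := by
    funext F
    have hφ : ∀ φ : AddChar B ℂ, ((Fintype.card B : ℂ)⁻¹ * φ (-z)) * (f F * φ (F x))
        = ((Fintype.card B : ℂ)⁻¹ * f F) * φ (F x - z) := fun φ => by
      rw [sub_eq_add_neg, AddChar.map_add_eq_mul]; ring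
    simp only [hφ]
    rw [← Finset.mul_sum, AddChar.sum_apply_eq_ite]
    simp only [sub_eq_zero]
    have : (Fintype.card B : ℂ) ≠ 0 := by exact_mod_cast Fintype.card_ne_zero
    split_ifs
    · field_simp
    · simp
  rw [h]
  exact HasFourierDegreeLE.sum _ fun φ _ => (hf.mul_char_eval x φ).const_mul _

end Fourier

/-! ### Bounded quadratic forms -/

/-- A quadratic form dominated by `N` varies slowly. -/
theorem QuadraticForm.abs_sub_le_of_abs_le {E : Type*} [AddCommGroup E] [Module ℝ E]
    (Q N : QuadraticForm ℝ E) (h : ∀ x, |Q x| ≤ N x) (u v : E) {t : ℝ} (ht : 0 < t) :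
    |Q u - Q v| ≤ (t * N (u - v) + N (u + v) / t) / 2 := by
  obtain ⟨r, hr, rfl⟩ : ∃ r : ℝ, 0 < r ∧ t = r ^ 2 :=
    ⟨√t, Real.sqrt_pos.2 ht, (Real.sq_sqrt ht.le).symm⟩
  have hadd : ∀ (P : QuadraticForm ℝ E) (x y : E), P (x + y) = P x + P y + QuadraticMap.polar P x y :=
    fun P x y => by simp [QuadraticMap.polar]
  have hsub : ∀ (P : QuadraticForm ℝ E) (x y : E), P (x - y) = P x + P y - QuadraticMap.polar P x y :=
    fun P x y => by
      rw [sub_eq_add_neg, hadd, QuadraticMap.map_neg, QuadraticMap.polar_neg_right]; ring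
  have hpol : 2 * (Q u - Q v) = QuadraticMap.polar Q (u + v) (u - v) := by
    rw [QuadraticMap.polar_sub_right, QuadraticMap.polar_add_left, QuadraticMap.polar_add_left,
      QuadraticMap.polar_self, QuadraticMap.polar_self, QuadraticMap.polar_comm Q v u]
    ring
  -- Reciprocal scaling keeps the polar form and introduces the weight `t = r ^ 2`; the bounds on `Q
  -- (x + y)` and `Q (x - y)` then control the polar form.
  set x := r⁻¹ • (u + v) with hx
  set y := r • (u - v) with hy
  have hxy : QuadraticMap.polar Q x y = 2 * (Q u - Q v) := by
    rw [hx, hy, QuadraticMap.polar_smul_left, QuadraticMap.polar_smul_right, hpol, smul_eq_mul,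
      smul_eq_mul, inv_mul_cancel_left₀ hr.ne']
  have hNx : N x = N (u + v) / r ^ 2 := by
    rw [hx, QuadraticMap.map_smul, smul_eq_mul]; field_simp
  have hNy : N y = r ^ 2 * N (u - v) := by
    rw [hy, QuadraticMap.map_smul, smul_eq_mul]; ring
  have h1 := abs_le.1 (h (x + y))
  have h2 := abs_le.1 (h (x - y))
  rw [hadd Q, hadd N] at h1
  rw [hsub Q, hsub N] at h2
  rw [← hNx, ← hNy, abs_le]
  constructor <;> linarith [h1.1, h1.2, h2.1, h2.2]

/-- A quadratic form with `0 ≤ Q ≤ N` varies even more slowly. -/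
theorem QuadraticForm.abs_sub_le_of_le {E : Type*} [AddCommGroup E] [Module ℝ E]
    (Q N : QuadraticForm ℝ E) (h0 : ∀ x, 0 ≤ Q x) (h1 : ∀ x, Q x ≤ N x) {u v : E}
    (huv : N u = N v) {t : ℝ} (ht : 0 < t) :
    |Q u - Q v| ≤ (t * N (u - v) + N (u + v) / t) / 4 := by
  -- The centred form `2Q - N` lies between `-N` and `N`; since `N u = N v`, its variation is twice
  -- that of `Q`, which gains a factor 2.
  have h := QuadraticForm.abs_sub_le_of_abs_le ((2 : ℝ) • Q - N) N (fun x => by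
    rw [sub_apply, smul_apply, smul_eq_mul, abs_le]
    constructor <;> linarith [h0 x, h1 x]) u v ht
  simp only [sub_apply, smul_apply, smul_eq_mul, huv] at h
  rw [show 2 * Q u - N v - (2 * Q v - N v) = 2 * (Q u - Q v) by ring, abs_mul, abs_two] at h
  linarith

theorem abs_expect_sub_expect_le {κ : Type*} [Fintype κ] {f g h : κ → ℝ}
    (hfg : ∀ i, |f i - g i| ≤ h i) : |𝔼 i, f i - 𝔼 i, g i| ≤ 𝔼 i, h i := by
  rw [← Finset.expect_sub_distrib]
  exact (Finset.abs_expect_le _ _).trans (Finset.expect_le_expect fun i _ => hfg i)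

/-- Resampling one value of a random function `F` changes the expectation of a bounded quadratic
form by little if the state depends little on that value. -/
theorem abs_expect_sub_expect_resampleMean_le {ι B E : Type*} [Fintype ι] [DecidableEq ι]
    [AddCommGroup B] [Fintype B] [AddCommGroup E] [Module ℝ E] [Module ℚ≥0 E]
    (Q : (ι → B) → QuadraticForm ℝ E) (N : QuadraticForm ℝ E) (h0 : ∀ F x, 0 ≤ Q F x)
    (h1 : ∀ F x, Q F x ≤ N x) (Ψ : (ι → B) → E) (s : ι) {t : ℝ} (ht : 0 < t) :
    |𝔼 F, Q F (Ψ F) - 𝔼 F, 𝔼 y, Q (Function.update F s y) (Ψ F)|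
      ≤ (t * 𝔼 F, N (Ψ F - resampleMean s Ψ F)
          + (𝔼 F, N (Ψ F + resampleMean s Ψ F)) / t) / 2 := by
  classical
  let D : (ι → B) → QuadraticForm ℝ E := fun F =>
    Q F - (Fintype.card B : ℝ)⁻¹ • ∑ y, Q (Function.update F s y)
  have hD : ∀ F x, D F x = Q F x - 𝔼 y, Q (Function.update F s y) x := fun F x => by
    simp only [D, sub_apply, smul_apply, sum_apply,
      smul_eq_mul]
    rw [Fintype.expect_eq_sum_div_card, div_eq_inv_mul]
  have hDN : ∀ F x, |D F x| ≤ N x := fun F x => by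
    have ha : 0 ≤ 𝔼 y, Q (Function.update F s y) x := Finset.expect_nonneg fun y _ => h0 _ _
    have hb : 𝔼 y, Q (Function.update F s y) x ≤ N x :=
      Finset.expect_le Finset.univ_nonempty fun y _ => h1 _ _
    rw [hD, abs_le]
    constructor <;> linarith [h0 F x, h1 F x]
  -- The averaged state does not depend on `F s`, so resampling that value has no effect on the
  -- expectation.
  have hzero : 𝔼 F, D F (resampleMean s Ψ F) = 0 := by
    simp only [hD]
    rw [Finset.expect_sub_distrib, sub_eq_zero,
      ← expect_resampleMean s fun F => Q F (resampleMean s Ψ F)]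
    simp only [resampleMean, Function.update_idem]
  have h := abs_expect_sub_expect_le fun F =>
    QuadraticForm.abs_sub_le_of_abs_le (D F) N (hDN F) (Ψ F) (resampleMean s Ψ F) ht
  rw [hzero, sub_zero] at h
  simp only [hD] at h
  rw [Finset.expect_sub_distrib] at h
  refine h.trans_eq ?_
  rw [← Finset.expect_div, Finset.expect_add_distrib, ← Finset.mul_expect, ← Finset.expect_div]

/-- This replaces Cauchy–Schwarz: bounds with a free `t` are linear in the squared norms and can be
averaged, and `t` is optimised only afterwards, at `√(β / α)`. -/
theorem le_two_mul_sqrt_of_forall_le {X α β : ℝ} (hα : 0 ≤ α) (hβ : 0 ≤ β)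
    (h : ∀ t : ℝ, 0 < t → X ≤ t * α + β / t) : X ≤ 2 * √(α * β) := by
  rcases hα.eq_or_lt with rfl | hα
  · simp only [mul_zero, zero_add, zero_mul, Real.sqrt_zero] at h ⊢
    by_contra! hX
    have := h ((β + 1) / X) (by positivity)
    rw [div_div_eq_mul_div, le_div_iff₀ (by positivity)] at this
    nlinarith
  rcases hβ.eq_or_lt with rfl | hβ
  · simp only [zero_div, add_zero, mul_zero, Real.sqrt_zero] at h ⊢
    by_contra! hX
    have := h (X / (2 * α)) (by positivity)
    rw [div_mul_eq_mul_div, le_div_iff₀ (by positivity)] at this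
    nlinarith
  · refine (h (√β / √α) (by positivity)).trans_eq ?_
    rw [Real.sqrt_mul hα.le]
    have ha := Real.sq_sqrt hα.le
    have hb := Real.sq_sqrt hβ.le
    have : 0 < √α := Real.sqrt_pos.2 hα
    have : 0 < √β := Real.sqrt_pos.2 hβ
    field_simp
    rw [ha, hb]; ring

/-! ### States and programs -/

/-- The squared norm of a state, as a real quadratic form. -/
noncomputable def regNormSq (n d : ℕ) : QuadraticForm ℝ (RegState n d) :=
  ∑ b, (QuadraticMap.sq.comp (Complex.reLm ∘ₗ LinearMap.proj b)
    + QuadraticMap.sq.comp (Complex.imLm ∘ₗ LinearMap.proj b))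

variable {n d : ℕ}

theorem regNormSq_apply (ψ : RegState n d) : regNormSq n d ψ = ∑ b, ‖ψ b‖ ^ 2 := by
  simp only [regNormSq, sum_apply, add_apply]
  refine Finset.sum_congr rfl fun b _ => ?_
  rw [← Complex.normSq_eq_norm_sq, Complex.normSq_apply]
  simp

theorem regNormSq_nonneg (ψ : RegState n d) : 0 ≤ regNormSq n d ψ := by
  rw [regNormSq_apply]; positivity

theorem regNormSq_add_le (φ ψ : RegState n d) :
    regNormSq n d (φ + ψ) ≤ 2 * regNormSq n d φ + 2 * regNormSq n d ψ := by
  simp only [regNormSq_apply, Finset.mul_sum]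
  rw [← Finset.sum_add_distrib]
  refine Finset.sum_le_sum fun b _ => ?_
  have h := norm_add_le (φ b) (ψ b)
  rw [Pi.add_apply]
  nlinarith [sq_nonneg (‖φ b‖ - ‖ψ b‖), norm_nonneg (φ b + ψ b)]

theorem sum_regNormSq_mulVec {m : ℕ} (K : Fin m → Matrix (RegBasis n d) (RegBasis n d) ℂ)
    (hK : ∑ i, (K i)ᴴ * K i = 1) (ψ : RegState n d) :
    ∑ i, regNormSq n d (K i *ᵥ ψ) = regNormSq n d ψ := by
  have h : ∀ φ : RegState n d, star φ ⬝ᵥ φ = ((regNormSq n d φ : ℝ) : ℂ) := fun φ => by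
    rw [regNormSq_apply, dotProduct]
    push_cast
    refine Finset.sum_congr rfl fun b _ => ?_
    rw [Pi.star_apply, mul_comm, Complex.star_def, Complex.mul_conj, Complex.normSq_eq_norm_sq]
    push_cast
    rfl
  have : ∑ i, star (K i *ᵥ ψ) ⬝ᵥ (K i *ᵥ ψ) = star ψ ⬝ᵥ ψ := by
    simp only [Matrix.star_mulVec, ← Matrix.dotProduct_mulVec, Matrix.mulVec_mulVec]
    rw [← dotProduct_sum, ← Matrix.sum_mulVec, hK, Matrix.one_mulVec]
  simp only [h] at this
  exact_mod_cast this

theorem Bits.add_self (a : Bits n) : a + a = 0 := by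
  funext i; exact CharTwo.add_self_eq_zero (a i)

theorem Bits.add_add_cancel (a b : Bits n) : a + b + b = a := by
  rw [add_assoc, Bits.add_self, add_zero]

/-- The permutation of the computational basis that a quantum query performs. -/
def oraclePerm (d : ℕ) (F : Bits n → Bits n) : Equiv.Perm (RegBasis n d) where
  toFun b := (b.1, b.2.1 + F b.1, b.2.2)
  invFun b := (b.1, b.2.1 + F b.1, b.2.2)
  left_inv b := by simp [Bits.add_add_cancel]
  right_inv b := by simp [Bits.add_add_cancel]

theorem quantumOracle_apply (F : Bits n → Bits n) (ψ : RegState n d) (b : RegBasis n d) :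
    quantumOracle F ψ b = ψ (oraclePerm d F b) := rfl

theorem regNormSq_quantumOracle (F : Bits n → Bits n) (ψ : RegState n d) :
    regNormSq n d (quantumOracle F ψ) = regNormSq n d ψ := by
  simp only [regNormSq_apply, quantumOracle_apply]
  exact Equiv.sum_comp (oraclePerm d F) fun b => ‖ψ b‖ ^ 2

/-- Queries to functions that agree outside of `S` have nearly the same effect on a state with
little weight on `S`. -/
theorem regNormSq_quantumOracle_sub_le (F F' : Bits n → Bits n) (S : Bits n → Prop)
    [DecidablePred S] (hS : ∀ x, ¬ S x → F x = F' x) (ψ : RegState n d) :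
    regNormSq n d (quantumOracle F ψ - quantumOracle F' ψ)
      ≤ 4 * ∑ b : RegBasis n d, if S b.1 then ‖ψ b‖ ^ 2 else 0 := by
  -- A query permutes the basis without changing the input register, so it preserves the weight on
  -- `S`.
  let g : RegBasis n d → ℝ := fun b => if S b.1 then ‖ψ b‖ ^ 2 else 0
  have h : ∀ b : RegBasis n d, ‖(quantumOracle F ψ - quantumOracle F' ψ) b‖ ^ 2
      ≤ 2 * g (oraclePerm d F b) + 2 * g (oraclePerm d F' b) := fun b => by
    rw [Pi.sub_apply, quantumOracle_apply, quantumOracle_apply]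
    by_cases hb : S b.1
    · have hg : ∀ F : Bits n → Bits n, g (oraclePerm d F b) = ‖ψ (oraclePerm d F b)‖ ^ 2 :=
        fun F => if_pos hb
      rw [hg, hg]
      have := norm_sub_le (ψ (oraclePerm d F b)) (ψ (oraclePerm d F' b))
      have h0 := norm_nonneg (ψ (oraclePerm d F b) - ψ (oraclePerm d F' b))
      nlinarith [sq_nonneg (‖ψ (oraclePerm d F b)‖ - ‖ψ (oraclePerm d F' b)‖)]
    · have : oraclePerm d F b = oraclePerm d F' b := by
        simp [oraclePerm, hS b.1 hb]
      have hg : 0 ≤ g (oraclePerm d F' b) := by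
        simp only [g]; split_ifs <;> positivity
      rw [this, sub_self, norm_zero]
      linarith
  rw [regNormSq_apply]
  refine (Finset.sum_le_sum fun b _ => h b).trans_eq ?_
  rw [Finset.sum_add_distrib, ← Finset.mul_sum, ← Finset.mul_sum,
    Equiv.sum_comp (oraclePerm d F) g, Equiv.sum_comp (oraclePerm d F') g]
  ring

namespace AdvProgram

theorem acceptProb_nonneg (O F : Bits n → Bits n) (P : AdvProgram n d) (ψ : RegState n d) :
    0 ≤ P.acceptProb O F ψ := by
  induction P generalizing ψ with
  | output b => simp only [acceptProb]; split_ifs <;> positivity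
  | measure K hK next ih => exact Finset.sum_nonneg fun i _ => ih i _
  | classicalQuery x next ih => exact ih _ _
  | quantumQuery next ih => exact ih _

theorem acceptProb_le (O F : Bits n → Bits n) (P : AdvProgram n d) (ψ : RegState n d) :
    P.acceptProb O F ψ ≤ regNormSq n d ψ := by
  induction P generalizing ψ with
  | output b =>
    simp only [acceptProb]
    split_ifs
    · rw [regNormSq_apply]
    · exact regNormSq_nonneg ψ
  | measure K hK next ih =>
    rw [← sum_regNormSq_mulVec K hK ψ]
    exact Finset.sum_le_sum fun i _ => ih i _
  | classicalQuery x next ih => exact ih _ _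
  | quantumQuery next ih => exact (ih _).trans_eq (regNormSq_quantumOracle F ψ)

/-- The acceptance probability is a quadratic form in the state. -/
theorem exists_quadraticForm_eq_acceptProb (O F : Bits n → Bits n) (P : AdvProgram n d) :
    ∃ Q : QuadraticForm ℝ (RegState n d), ∀ ψ, Q ψ = P.acceptProb O F ψ := by
  induction P with
  | output b =>
    cases b
    · exact ⟨0, fun ψ => by simp [acceptProb]⟩
    · exact ⟨regNormSq n d, fun ψ => by simp [acceptProb, regNormSq_apply]⟩
  | measure K hK next ih =>
    choose Q hQ using ih
    refine ⟨∑ i, (Q i).comp ((Matrix.mulVecLin (K i)).restrictScalars ℝ), fun ψ => ?_⟩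
    simp [acceptProb, hQ]
  | classicalQuery x next ih => exact ih _
  | quantumQuery next ih =>
    obtain ⟨Q, hQ⟩ := ih
    exact ⟨Q.comp (LinearMap.funLeft ℝ ℂ (oraclePerm d F)), fun ψ => hQ _⟩

end AdvProgram

/-! ### Reprogramming and the hybrid argument -/

theorem card_bits (n : ℕ) : Fintype.card (Bits n) = 2 ^ n := by
  simp [ZMod.card]

/-- The function `F`, reprogrammed to `y` at `x ⊕ k` for every entry `(x, y)` of the table `T`. -/
def reprogram (T : Bits n → Option (Bits n)) (k : Bits n) (F : Bits n → Bits n) :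
    Bits n → Bits n :=
  fun x => (T (x + k)).getD (F x)

/-- The number of entries of a table. -/
def tableSize (T : Bits n → Option (Bits n)) : ℕ :=
  (Finset.univ.filter fun x => (T x).isSome).card

theorem tableSize_update_le (T : Bits n → Option (Bits n)) (x y : Bits n) :
    tableSize (Function.update T x (some y)) ≤ tableSize T + 1 := by
  refine (Finset.card_le_card (t := insert x (Finset.univ.filter fun x => (T x).isSome)) ?_).trans
    (Finset.card_insert_le _ _)
  intro z hz
  by_cases hzx : z = x
  · simp [hzx]
  · simpa [hzx] using hz

theorem forwardCipher_reprogram_apply (T : Bits n → Option (Bits n)) (k : Bits n)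
    (F : Bits n → Bits n) (x : Bits n) :
    forwardCipher (reprogram T k F) k x = (T x).getD (F (x + k)) := by
  simp [forwardCipher, reprogram, Bits.add_add_cancel]

/-- This identifies resampling `F` at the point a fresh query hits with recording the reply in the
table. -/
theorem reprogram_update {T : Bits n → Option (Bits n)} {x : Bits n} (hx : T x = none)
    (k : Bits n) (F : Bits n → Bits n) (y : Bits n) :
    reprogram T k (Function.update F (x + k) y)
      = reprogram (Function.update T x (some y)) k F := by
  funext z
  by_cases hz : z = x + k
  · subst hz
    simp [reprogram, Bits.add_add_cancel, hx]
  · have hz' : z + k ≠ x := fun h => hz (by rw [← h, Bits.add_add_cancel])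
    simp [reprogram, hz, hz']

/-- The average squared norm of a state that depends on a random function. -/
noncomputable def weight (Ψ : (Bits n → Bits n) → RegState n d) : ℝ :=
  𝔼 F, regNormSq n d (Ψ F)

theorem weight_nonneg (Ψ : (Bits n → Bits n) → RegState n d) : 0 ≤ weight Ψ :=
  Finset.expect_nonneg fun _ _ => regNormSq_nonneg _

/-- Every amplitude of `Ψ` has Fourier degree at most `q` in the random function. -/
def StateDegreeLE (q : ℕ) (Ψ : (Bits n → Bits n) → RegState n d) : Prop :=
  ∀ b, HasFourierDegreeLE q fun F => Ψ F b

theorem StateDegreeLE.mulVec {q : ℕ} {Ψ : (Bits n → Bits n) → RegState n d}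
    (h : StateDegreeLE q Ψ) (K : Matrix (RegBasis n d) (RegBasis n d) ℂ) :
    StateDegreeLE q fun F => K *ᵥ Ψ F := fun b => by
  simp only [Matrix.mulVec, dotProduct]
  exact HasFourierDegreeLE.sum _ fun i _ => (h i).const_mul _

/-- The new amplitude splits according to the single value `F b.1`, which costs one degree. -/
theorem StateDegreeLE.quantumOracle {q : ℕ} {Ψ : (Bits n → Bits n) → RegState n d}
    (h : StateDegreeLE q Ψ) : StateDegreeLE (q + 1) fun F => quantumOracle F (Ψ F) := fun b => by
  have : (fun F : Bits n → Bits n => _root_.quantumOracle F (Ψ F) b)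
      = fun F => ∑ z, if F b.1 = z then Ψ F (b.1, b.2.1 + z, b.2.2) else 0 := by
    funext F
    simp [_root_.quantumOracle]
  rw [this]
  exact HasFourierDegreeLE.sum _ fun z _ => (h _).mul_indicator _ _

theorem resampleMean_apply (s : Bits n) (Ψ : (Bits n → Bits n) → RegState n d)
    (F : Bits n → Bits n) (b : RegBasis n d) :
    resampleMean s Ψ F b = resampleMean s (fun F => Ψ F b) F := by
  simp [resampleMean, Finset.expect_apply]

theorem expect_regNormSq (Ψ : (Bits n → Bits n) → RegState n d) :
    𝔼 F, regNormSq n d (Ψ F)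
      = (∑ b, ∑ F, ‖Ψ F b‖ ^ 2) / Fintype.card (Bits n → Bits n) := by
  simp only [regNormSq_apply]
  rw [Fintype.expect_eq_sum_div_card, Finset.sum_comm]

theorem expect_regNormSq_add_resampleMean_le (s : Bits n)
    (Ψ : (Bits n → Bits n) → RegState n d) :
    𝔼 F, regNormSq n d (Ψ F + resampleMean s Ψ F) ≤ 4 * weight Ψ := by
  rw [weight, expect_regNormSq, expect_regNormSq, ← mul_div_assoc, Finset.mul_sum]
  gcongr with b
  simp only [Pi.add_apply, resampleMean_apply]
  exact sum_norm_sq_add_resampleMean_le s fun F => Ψ F b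

/-- For uniform `k` the point `x + k` is uniform, so this is the total influence divided by `2 ^ n`.
-/
theorem expect_expect_regNormSq_sub_resampleMean_le {q : ℕ}
    {Ψ : (Bits n → Bits n) → RegState n d} (h : StateDegreeLE q Ψ) (x : Bits n) :
    𝔼 k, 𝔼 F, regNormSq n d (Ψ F - resampleMean (x + k) Ψ F) ≤ q / 2 ^ n * weight Ψ := by
  rw [Fintype.expect_equiv (Equiv.addLeft x)
    (fun k => 𝔼 F, regNormSq n d (Ψ F - resampleMean (x + k) Ψ F))
    (fun s => 𝔼 F, regNormSq n d (Ψ F - resampleMean s Ψ F)) fun k => rfl,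
    Fintype.expect_eq_sum_div_card, card_bits, weight]
  simp only [expect_regNormSq]
  rw [← Finset.sum_div, Finset.sum_comm, div_mul_eq_mul_div]
  push_cast
  gcongr
  rw [← mul_div_assoc, Finset.mul_sum]
  gcongr with b
  simp only [Pi.sub_apply, resampleMean_apply]
  exact sum_sum_norm_sq_sub_resampleMean_le (h b)

namespace AdvProgram

/-- Acceptance probability in the real world, started at `Ψ` after the classical replies in the
table `T`: the oracles are `F`, reprogrammed to agree with `T`, and its cipher. -/
noncomputable def realProb (P : AdvProgram n d) (T : Bits n → Option (Bits n))
    (Ψ : (Bits n → Bits n) → RegState n d) : ℝ :=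
  𝔼 k, 𝔼 F, P.acceptProb (forwardCipher (reprogram T k F) k) (reprogram T k F) (Ψ F)

/-- Acceptance probability in the ideal world, started at `Ψ` after the classical replies in the
table `T`. -/
noncomputable def idealProb (P : AdvProgram n d) (T : Bits n → Option (Bits n))
    (Ψ : (Bits n → Bits n) → RegState n d) : ℝ :=
  𝔼 R, 𝔼 F, P.acceptProb (reprogram T 0 R) F (Ψ F)

/-- Lazy sampling: the value of `R` at a point outside the table may be drawn when it is asked for.
-/
theorem idealProb_classicalQuery (x : Bits n) (next : Bits n → AdvProgram n d)
    {T : Bits n → Option (Bits n)} (hx : T x = none) (Ψ : (Bits n → Bits n) → RegState n d) :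
    (classicalQuery x next).idealProb T Ψ
      = 𝔼 y, (next y).idealProb (Function.update T x (some y)) Ψ := by
  simp only [idealProb]
  rw [← expect_resampleMean x fun R =>
    𝔼 F, (classicalQuery x next).acceptProb (reprogram T 0 R) F (Ψ F)]
  conv_rhs => rw [Finset.expect_comm]
  refine Finset.expect_congr rfl fun R _ => Finset.expect_congr rfl fun y _ => ?_
  have h := reprogram_update hx 0 R y
  rw [add_zero] at h
  have hy : reprogram (Function.update T x (some y)) 0 R x = y := by simp [reprogram]
  simp only [acceptProb, h, hy]

/-- In the real world a fresh classical reply may be replaced by an independent uniform one, to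
which `F` is reprogrammed afterwards. -/
theorem abs_realProb_classicalQuery_sub_le (x : Bits n) (next : Bits n → AdvProgram n d)
    {T : Bits n → Option (Bits n)} (hx : T x = none) {q : ℕ}
    {Ψ : (Bits n → Bits n) → RegState n d} (hΨ : StateDegreeLE q Ψ) :
    |(classicalQuery x next).realProb T Ψ
        - 𝔼 y, (next y).realProb (Function.update T x (some y)) Ψ|
      ≤ weight Ψ * (2 / √(2 ^ n)) * √q := by
  have hw := weight_nonneg Ψ
  choose Q hQ using fun k F => exists_quadraticForm_eq_acceptProb
    (forwardCipher (reprogram T k F) k) (reprogram T k F) (classicalQuery x next)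
  have h1 : (classicalQuery x next).realProb T Ψ = 𝔼 k, 𝔼 F, Q k F (Ψ F) := by
    simp only [realProb, hQ]
  have h2 : 𝔼 y, (next y).realProb (Function.update T x (some y)) Ψ
      = 𝔼 k, 𝔼 F, 𝔼 y, Q k (Function.update F (x + k) y) (Ψ F) := by
    simp only [realProb, hQ]
    rw [Finset.expect_comm]
    refine Finset.expect_congr rfl fun k _ => ?_
    rw [Finset.expect_comm]
    refine Finset.expect_congr rfl fun F _ => Finset.expect_congr rfl fun y _ => ?_
    rw [acceptProb, reprogram_update hx, forwardCipher_reprogram_apply]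
    simp
  have h3 : |(classicalQuery x next).realProb T Ψ
        - 𝔼 y, (next y).realProb (Function.update T x (some y)) Ψ|
      ≤ 2 * √((q / 2 ^ n * weight Ψ / 2) * (2 * weight Ψ)) := by
    refine le_two_mul_sqrt_of_forall_le (by positivity) (by positivity) fun t ht => ?_
    rw [h1, h2]
    refine (abs_expect_sub_expect_le fun k => abs_expect_sub_expect_resampleMean_le (Q k)
      (regNormSq n d) (fun F ψ => (hQ k F ψ).symm ▸ acceptProb_nonneg _ _ _ _)
      (fun F ψ => (hQ k F ψ).symm ▸ acceptProb_le _ _ _ _) Ψ (x + k) ht).trans ?_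
    rw [← Finset.expect_div, Finset.expect_add_distrib, ← Finset.mul_expect, ← Finset.expect_div]
    have ha := expect_expect_regNormSq_sub_resampleMean_le hΨ x
    have hb : 𝔼 k, 𝔼 F, regNormSq n d (Ψ F + resampleMean (x + k) Ψ F) ≤ 4 * weight Ψ :=
      Finset.expect_le Finset.univ_nonempty fun k _ => expect_regNormSq_add_resampleMean_le _ Ψ
    calc _ ≤ (t * (q / 2 ^ n * weight Ψ) + 4 * weight Ψ / t) / 2 := by gcongr
      _ = _ := by ring
  refine h3.trans_eq ?_
  rw [show (q / 2 ^ n * weight Ψ / 2) * (2 * weight Ψ) = weight Ψ ^ 2 * (q / 2 ^ n : ℝ) by ring,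
    Real.sqrt_mul (sq_nonneg _), Real.sqrt_sq hw, Real.sqrt_div (Nat.cast_nonneg q)]
  ring

/-- The state is independent of `k`, so each basis vector meets the shifted table with probability
`tableSize T / 2 ^ n`. -/
theorem expect_expect_sum_ite_eq (T : Bits n → Option (Bits n))
    (Ψ : (Bits n → Bits n) → RegState n d) :
    𝔼 k, 𝔼 F, ∑ b : RegBasis n d, (if (T (b.1 + k)).isSome then ‖Ψ F b‖ ^ 2 else 0)
      = tableSize T / 2 ^ n * weight Ψ := by
  rw [Finset.expect_comm, weight, Finset.mul_expect]
  refine Finset.expect_congr rfl fun F _ => ?_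
  rw [Finset.expect_sum_comm, regNormSq_apply, Finset.mul_sum]
  refine Finset.sum_congr rfl fun b _ => ?_
  rw [Fintype.expect_equiv (Equiv.addLeft b.1)
    (fun k => if (T (b.1 + k)).isSome then ‖Ψ F b‖ ^ 2 else 0)
    (fun z => if (T z).isSome then ‖Ψ F b‖ ^ 2 else 0) fun k => rfl,
    Fintype.expect_eq_sum_div_card, card_bits, ← Finset.sum_filter, Finset.sum_const, tableSize,
    nsmul_eq_mul]
  push_cast
  ring

/-- In the real world a quantum query to the reprogrammed function may be replaced by one to `F`
itself. -/
theorem abs_realProb_quantumQuery_sub_le (next : AdvProgram n d) (T : Bits n → Option (Bits n))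
    (Ψ : (Bits n → Bits n) → RegState n d) :
    |(quantumQuery next).realProb T Ψ - next.realProb T fun F => quantumOracle F (Ψ F)|
      ≤ weight Ψ * (2 / √(2 ^ n)) * √(tableSize T) := by
  have hw := weight_nonneg Ψ
  have h3 : |(quantumQuery next).realProb T Ψ - next.realProb T fun F => quantumOracle F (Ψ F)|
      ≤ 2 * √((tableSize T / 2 ^ n * weight Ψ) * weight Ψ) := by
    refine le_two_mul_sqrt_of_forall_le (by positivity) hw fun t ht => ?_
    have key : ∀ k F, |(quantumQuery next).acceptProb (forwardCipher (reprogram T k F) k)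
          (reprogram T k F) (Ψ F) - next.acceptProb (forwardCipher (reprogram T k F) k)
          (reprogram T k F) (quantumOracle F (Ψ F))|
        ≤ t * (∑ b : RegBasis n d, (if (T (b.1 + k)).isSome then ‖Ψ F b‖ ^ 2 else 0))
          + regNormSq n d (Ψ F) / t := fun k F => by
      obtain ⟨Q, hQ⟩ := exists_quadraticForm_eq_acceptProb
        (forwardCipher (reprogram T k F) k) (reprogram T k F) next
      rw [acceptProb, ← hQ, ← hQ]
      refine (QuadraticForm.abs_sub_le_of_le Q (regNormSq n d)
        (fun ψ => (hQ ψ).symm ▸ acceptProb_nonneg _ _ _ _)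
        (fun ψ => (hQ ψ).symm ▸ acceptProb_le _ _ _ _)
        (by rw [regNormSq_quantumOracle, regNormSq_quantumOracle]) ht).trans ?_
      have ha := regNormSq_quantumOracle_sub_le (reprogram T k F) F
        (fun x => (T (x + k)).isSome) (fun x hx => by
          rw [Option.not_isSome_iff_eq_none] at hx
          simp [reprogram, hx]) (Ψ F)
      have hb := regNormSq_add_le (quantumOracle (reprogram T k F) (Ψ F)) (quantumOracle F (Ψ F))
      rw [regNormSq_quantumOracle, regNormSq_quantumOracle] at hb
      calc _ ≤ (t * (4 * _) + (2 * regNormSq n d (Ψ F) + 2 * regNormSq n d (Ψ F)) / t) / 4 := by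
            gcongr
        _ = _ := by ring
    refine (abs_expect_sub_expect_le fun k => abs_expect_sub_expect_le fun F => key k F).trans_eq ?_
    simp only [Finset.expect_add_distrib, ← Finset.mul_expect, ← Finset.expect_div]
    rw [expect_expect_sum_ite_eq, Fintype.expect_const, ← weight]
  refine h3.trans_eq ?_
  rw [show (tableSize T / 2 ^ n * weight Ψ) * weight Ψ
      = weight Ψ ^ 2 * (tableSize T / 2 ^ n : ℝ) by ring,
    Real.sqrt_mul (sq_nonneg _), Real.sqrt_sq hw, Real.sqrt_div (Nat.cast_nonneg _)]
  ring

theorem sum_weight_mulVec {m : ℕ} (K : Fin m → Matrix (RegBasis n d) (RegBasis n d) ℂ)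
    (hK : ∑ i, (K i)ᴴ * K i = 1) (Ψ : (Bits n → Bits n) → RegState n d) :
    ∑ i, weight (fun F => K i *ᵥ Ψ F) = weight Ψ := by
  simp only [weight]
  rw [← Finset.expect_sum_comm]
  simp only [sum_regNormSq_mulVec K hK]

/-- The real and the ideal world are indistinguishable with few queries. -/
theorem abs_realProb_sub_idealProb_le (P : AdvProgram n d) {c m : ℕ}
    (hc : P.classicalQueries ≤ c) (hm : P.quantumQueries ≤ m) (T : Bits n → Option (Bits n))
    {j : ℕ} (hT : tableSize T ≤ j) {q : ℕ} {Ψ : (Bits n → Bits n) → RegState n d}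
    (hΨ : StateDegreeLE q Ψ) :
    |P.realProb T Ψ - P.idealProb T Ψ|
      ≤ weight Ψ * (2 / √(2 ^ n)) * (c * √((q + m : ℕ)) + m * √((j + c : ℕ))) := by
  induction P generalizing c m T j q Ψ with
  | output b =>
    have hw := weight_nonneg Ψ
    -- The output rule consults no oracle, so neither `k` nor `R` matters any more.
    have : (output b : AdvProgram n d).realProb T Ψ = (output b : AdvProgram n d).idealProb T Ψ := by
      simp only [realProb, idealProb, acceptProb]
      rw [Fintype.expect_const, Fintype.expect_const]
    rw [this, sub_self, abs_zero]
    positivity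
  | measure K hK next ih =>
    simp only [classicalQueries, quantumQueries, Finset.sup_le_iff] at hc hm
    have h1 : (measure K hK next).realProb T Ψ
        = ∑ i, (next i).realProb T fun F => K i *ᵥ Ψ F := by
      simp only [realProb, acceptProb, Finset.expect_sum_comm]
    have h2 : (measure K hK next).idealProb T Ψ
        = ∑ i, (next i).idealProb T fun F => K i *ᵥ Ψ F := by
      simp only [idealProb, acceptProb, Finset.expect_sum_comm]
    rw [h1, h2, ← Finset.sum_sub_distrib, ← sum_weight_mulVec K hK Ψ, Finset.sum_mul,
      Finset.sum_mul]
    refine (Finset.abs_sum_le_sum_abs _ _).trans (Finset.sum_le_sum fun i _ => ?_)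
    exact ih i (hc i (Finset.mem_univ i)) (hm i (Finset.mem_univ i)) T hT (hΨ.mulVec _)
  | classicalQuery x next ih =>
    have hw := weight_nonneg Ψ
    simp only [classicalQueries, quantumQueries] at hc hm
    obtain ⟨c, rfl⟩ : ∃ c', c = c' + 1 := ⟨c - 1, by omega⟩
    rw [Nat.add_le_add_iff_right] at hc
    simp only [Finset.sup_le_iff] at hc hm
    cases hx : T x with
    | some y =>
      -- A repeated query is answered from the table in both worlds, at no cost.
      have h1 : (classicalQuery x next).realProb T Ψ = (next y).realProb T Ψ := by
        simp only [realProb, acceptProb, forwardCipher_reprogram_apply, hx, Option.getD_some]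
      have h2 : (classicalQuery x next).idealProb T Ψ = (next y).idealProb T Ψ := by
        simp only [idealProb, acceptProb, reprogram, add_zero, hx, Option.getD_some]
      rw [h1, h2]
      exact ih y ((hc y (Finset.mem_univ y)).trans (Nat.le_succ c)) (hm y (Finset.mem_univ y))
        T hT hΨ
    | none =>
      rw [idealProb_classicalQuery x next hx]
      have h1 := abs_realProb_classicalQuery_sub_le x next hx hΨ
      have h2 := abs_expect_sub_expect_le fun y => ih y (hc y (Finset.mem_univ y))
        (hm y (Finset.mem_univ y)) (Function.update T x (some y))
        ((tableSize_update_le T x y).trans (Nat.add_le_add_right hT 1)) hΨ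
      rw [Fintype.expect_const] at h2
      refine (abs_sub_le _ _ _).trans ((add_le_add h1 h2).trans ?_)
      rw [← mul_add]
      refine mul_le_mul_of_nonneg_left ?_ (by positivity)
      have h3 : √(q : ℝ) ≤ √((q + m : ℕ) : ℝ) := Real.sqrt_le_sqrt (by simp)
      -- The new table entry is paid for by the query just spent: entries plus remaining classical
      -- queries stay constant.
      rw [show j + 1 + c = j + (c + 1) by omega]
      push_cast at h3 ⊢
      linarith
  | quantumQuery next ih =>
    have hw := weight_nonneg Ψ
    simp only [classicalQueries, quantumQueries] at hc hm
    obtain ⟨m, rfl⟩ : ∃ m', m = m' + 1 := ⟨m - 1, by omega⟩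
    rw [Nat.add_le_add_iff_right] at hm
    have h1 := abs_realProb_quantumQuery_sub_le next T Ψ
    have h2 := ih hc hm T hT hΨ.quantumOracle
    have hideal : (quantumQuery next).idealProb T Ψ
        = next.idealProb T fun F => quantumOracle F (Ψ F) := rfl
    have hweight : weight (fun F => quantumOracle F (Ψ F)) = weight Ψ := by
      simp only [weight, regNormSq_quantumOracle]
    rw [hweight] at h2
    rw [hideal]
    refine (abs_sub_le _ _ _).trans ((add_le_add h1 h2).trans ?_)
    rw [← mul_add]
    refine mul_le_mul_of_nonneg_left ?_ (by positivity)
    have h3 : √(tableSize T : ℝ) ≤ √((j + c : ℕ) : ℝ) :=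
      Real.sqrt_le_sqrt (by exact_mod_cast hT.trans (Nat.le_add_right j c))
    -- Likewise, degree plus remaining quantum queries stays constant.
    rw [show q + 1 + m = q + (m + 1) by omega]
    push_cast at h3 ⊢
    linarith

end AdvProgram

theorem mainTheorem4 (n qE qF : ℕ) (A : OracleAdversary n) (hA : A.MakesQueries qE qF) :
    |(𝔼 k : Bits n, 𝔼 F : Bits n → Bits n, A.prob (forwardCipher F k) F)
        - 𝔼 R : Bits n → Bits n, 𝔼 F : Bits n → Bits n, A.prob R F|
      ≤ (2 : ℝ) ^ (-(n : ℝ) / 2)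
          * (2 * (qE : ℝ) * Real.sqrt (qF : ℝ) + 2 * (qF : ℝ) * Real.sqrt (qE : ℝ)) := by
  -- With the empty table reprogramming does nothing, so these are the original two worlds; the
  -- initial state does not depend on `F` and has degree 0.
  have h := A.program.abs_realProb_sub_idealProb_le hA.1 hA.2 (fun _ => none) (j := 0)
    (by simp [tableSize]) (q := 0) (Ψ := fun _ => A.init) fun b => hasFourierDegreeLE_const _
  have hw : weight (fun _ : Bits n → Bits n => A.init) = 1 := by
    rw [weight, Fintype.expect_const, regNormSq_apply, A.init_norm]
  have hpow : (2 : ℝ) ^ (-(n : ℝ) / 2) = 1 / √(2 ^ n) := by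
    rw [Real.sqrt_eq_rpow, ← Real.rpow_natCast, ← Real.rpow_mul zero_le_two, one_div,
      ← Real.rpow_neg zero_le_two]
    congr 1
    ring
  rw [hw, zero_add, zero_add] at h
  refine h.trans_eq ?_
  rw [hpow]
  ring
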